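/- Let $M_n$ be the space of complex $n\times n$ matrices, equipped with the operator norm on $\mathbb{C}^n$ (with its Euclidean norm), and let $B_{M_n}=\{x\in M_n : \|x\|\le 1\}$. For $\chi\ge 1$ let $A^\chi_n\subset M_n$ be the set of $n\times n$ matrices all of whose entries belong to $\{1/\sqrt n,-1/\sqrt n\}$ and whose operator norm is at most $\chi$, and put $A^\chi_nA^\chi_n=\{a'a'' : a',a''\in A^\chi_n\}$. Let $|x|=(x^*x)^{1/2}$, and let $\mathrm{absconv}[S]$ denote the absolutely convex hull of $S$ over $\mathbb{C}$, i.e. the smallest convex set containing $S$ that is stable under multiplication by complex scalars of modulus at most $1$. Then there are numerical constants $\chi\ge 1$ and $C>0$ such that for all $n\ge 1$: $$\forall x\in M_n\qquad \mathrm{tr}|x|\le C\sup_{a',a''\in A^\chi_n}|\mathrm{tr}(x\,a'a'')|,$$ and, equivalently (with the same $\chi$ and $C$), $$\chi^{-2}\,\mathrm{absconv}[A^\chi_nA^\chi_n]\subset B_{M_n}\subset C\,\mathrm{absconv}[A^\chi_nA^\chi_n].$$ -/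

import Mathlib

open scoped Pointwise ComplexOrder MatrixOrder Matrix.Norms.L2Operator

/-- The set of `n × n` matrices all of whose entries are `±1/√n` and whose operator norm, as an
operator on the Hilbert space `ℂⁿ`, is at most `χ`. -/
def signMatrices (χ : ℝ) (n : ℕ) : Set (Matrix (Fin n) (Fin n) ℂ) :=
  {a | (∀ i j, a i j = ((1 / √(n : ℝ) : ℝ) : ℂ) ∨ a i j = ((-(1 / √(n : ℝ)) : ℝ) : ℂ)) ∧ ‖a‖ ≤ χ}

/-- `tr |x|`, where `|x| = (xᴴ x)^{1/2}` is the absolute value given by the continuous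
functional calculus; the trace of this positive semidefinite matrix is real. -/
noncomputable def traceNorm {n : ℕ} (x : Matrix (Fin n) (Fin n) ℂ) : ℝ :=
  (Matrix.trace (CFC.abs x)).re

/-- There are finitely many sign matrices, so suprema over them are suprema of finite sets. -/
theorem signMatrices_finite (χ : ℝ) (n : ℕ) : (signMatrices χ n).Finite := by
  refine Set.Finite.subset (Set.Finite.pi' (fun _ : Fin n => Set.Finite.pi' (fun _ : Fin n =>
    Set.toFinite {((1 / √(n : ℝ) : ℝ) : ℂ), ((-(1 / √(n : ℝ)) : ℝ) : ℂ)}))) ?_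
  intro a ha i j
  simpa using ha.1 i j

/-! The inclusion of the ball in a multiple of the hull carries everything; the trace inequality
follows from it by polar decomposition, and the other inclusion is submultiplicativity of the norm.
Take a real contraction `u`. It dilates to a coisometry, so there are orthonormal families `Y (i,
j)` and `X (j, k)` with inner product `u i k` for every `j` (`exists_orthonormal_families`). For a
rotation-invariant random vector `G`, the signs of `⟨Y, G⟩` and of `⟨X, G⟩` give two sign matrices,
each uniformly distributed but correlated with one another. By Grothendieck's identity their
normalised product has expectation `2 / π * arcsin (u i k)`. After multiplication by `π / 2` the
error is entrywise at most `2 / 3 * u i k ^ 2`, hence of norm at most `2 / 3` by Schur's test.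
Uniform sign matrices have norm above `50` with exponentially small probability
(`card_norm_signMat_gt_le`), so discarding those outcomes costs little. Thus `u` is within `5 / 6 <
1` of `(π / 2) • K`, where `K` is the real hull (`exists_approx_signProducts`). Iterating on the
remainder and using that `K` is closed gives the unit ball inside `3π • K`; real and imaginary parts
then give `6π` over `ℂ`. -/

/-! ### Operator norm of random sign matrices, by a lattice net. -/

/-- Round each coordinate to the lattice of mesh `1 / (2√n)`. The error per coordinate is at most `1
/ (4√n)`, and a rounded vector of norm at most `5 / 4` has `∑ x i ^ 2 ≤ 25 / 4 * n`, below `7 * n`.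
-/
theorem exists_int_approx {n : ℕ} (hn : 1 ≤ n) (v : EuclideanSpace ℝ (Fin n)) (hv : ‖v‖ = 1) :
    ∃ x : Fin n → ℤ, ∑ i, (x i : ℝ) ^ 2 ≤ 7 * n ∧
      ‖v - WithLp.toLp 2 (fun i => (x i : ℝ) / (2 * √n))‖ ≤ 1 / 4 := by
  have hn' : (1 : ℝ) ≤ n := by exact_mod_cast hn
  have hs : 0 < √(n : ℝ) := Real.sqrt_pos.2 (by linarith)
  have hss : √(n : ℝ) * √n = n := Real.mul_self_sqrt (by linarith)
  have happ : ‖v - WithLp.toLp 2 (fun i => (round (2 * √n * v i) : ℝ) / (2 * √n))‖ ≤ 1 / 4 := by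
    rw [EuclideanSpace.norm_eq]
    apply Real.sqrt_le_iff.2 ⟨by norm_num, ?_⟩
    calc ∑ i, ‖(v - WithLp.toLp 2 (fun i => (round (2 * √n * v i) : ℝ) / (2 * √n))) i‖ ^ 2
        ≤ ∑ _i : Fin n, (1 / (16 * n) : ℝ) := by
          refine Finset.sum_le_sum fun i _ => ?_
          have h := abs_sub_round (2 * √n * v i)
          have e : (v - WithLp.toLp 2 (fun i => (round (2 * √n * v i) : ℝ) / (2 * √n))) i
              = (2 * √n * v i - round (2 * √n * v i)) / (2 * √n) := by
            simp; field_simp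
          have h2 : (2 * √n * v i - round (2 * √n * v i)) ^ 2 ≤ (1 / 2) ^ 2 := sq_le_sq' (abs_le.1 h).1 (abs_le.1 h).2
          rw [e, Real.norm_eq_abs, sq_abs, div_pow, mul_pow, Real.sq_sqrt (by linarith),
            div_le_div_iff₀ (by positivity) (by positivity)]
          nlinarith
      _ = (1 / 4) ^ 2 := by
          simp; field_simp; norm_num
  refine ⟨fun i => round (2 * √n * v i), ?_, happ⟩
  set w : EuclideanSpace ℝ (Fin n) :=
    WithLp.toLp 2 (fun i => (round (2 * √n * v i) : ℝ) / (2 * √n)) with hw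
  have h1 : ‖w‖ ≤ 5 / 4 := by
    have := norm_sub_norm_le w v
    rw [norm_sub_rev] at this
    linarith
  have h2 : ‖w‖ ^ 2 ≤ (5 / 4) ^ 2 := by gcongr
  rw [EuclideanSpace.norm_sq_eq] at h2
  have h3 : ∑ i, ‖w i‖ ^ 2 = (∑ i, (round (2 * √n * v i) : ℝ) ^ 2) / (4 * n) := by
    rw [Finset.sum_div]
    refine Finset.sum_congr rfl fun i _ => ?_
    rw [hw, Real.norm_eq_abs, sq_abs, div_pow, mul_pow, Real.sq_sqrt (by linarith)]
    norm_num
  rw [h3, div_le_iff₀ (by linarith)] at h2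
  linarith

theorem norm_le_of_int_bilin_le {n : ℕ} (hn : 1 ≤ n) (M : Matrix (Fin n) (Fin n) ℝ) (t : ℝ)
    (h : ∀ x y : Fin n → ℤ, ∑ i, (x i : ℝ) ^ 2 ≤ 7 * n → ∑ i, (y i : ℝ) ^ 2 ≤ 7 * n →
      ∑ i, ∑ j, (x i : ℝ) * M i j * y j ≤ t * n) : ‖M‖ ≤ t := by
  have hn' : (1 : ℝ) ≤ n := by exact_mod_cast hn
  have hss : √(n : ℝ) * √n = n := Real.mul_self_sqrt (by linarith)
  have ht : 0 ≤ t := by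
    have := h 0 0 (by simp) (by simp)
    simp at this
    nlinarith
  rw [← Matrix.l2_opNorm_toEuclideanCLM]
  set T := Matrix.toEuclideanCLM (n := Fin n) (𝕜 := ℝ) M with hT
  have key : ‖T‖ ≤ t / 4 + 9 / 16 * ‖T‖ := by
    refine ContinuousLinearMap.opNorm_le_of_unit_norm (by positivity) fun v hv => ?_
    by_cases h0 : T v = 0
    · rw [h0, norm_zero]; positivity
    have hp : 0 < ‖T v‖ := norm_pos_iff.2 h0
    set w := ‖T v‖⁻¹ • T v with hw
    have hw1 : ‖w‖ = 1 := by
      rw [hw, norm_smul, norm_inv, norm_norm, inv_mul_cancel₀ hp.ne']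
    have hwv : inner ℝ w (T v) = ‖T v‖ := by
      rw [hw, real_inner_smul_left, real_inner_self_eq_norm_sq]
      field_simp
    obtain ⟨x, hx, hx'⟩ := exists_int_approx hn w hw1
    obtain ⟨y, hy, hy'⟩ := exists_int_approx hn v hv
    set a : EuclideanSpace ℝ (Fin n) := WithLp.toLp 2 (fun i => (x i : ℝ) / (2 * √n)) with ha
    set b : EuclideanSpace ℝ (Fin n) := WithLp.toLp 2 (fun i => (y i : ℝ) / (2 * √n)) with hb
    have hab : inner ℝ a (T b) ≤ t / 4 := by
      have : inner ℝ a (T b) = (∑ i, ∑ j, (x i : ℝ) * M i j * y j) / (4 * n) := by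
        rw [PiLp.inner_apply, Finset.sum_div]
        refine Finset.sum_congr rfl fun i _ => ?_
        rw [hT, Matrix.ofLp_toEuclideanCLM, Matrix.mulVec, dotProduct, Finset.sum_div,
          real_inner_comm, ha, hb]
        simp only [RCLike.inner_apply, conj_trivial, Finset.mul_sum]
        refine Finset.sum_congr rfl fun j _ => ?_
        have h4 : (4 * n : ℝ) = 2 * √n * (2 * √n) := by linear_combination (-4) * hss
        rw [h4]
        generalize √(n : ℝ) = r
        ring
      rw [this, div_le_iff₀ (by linarith)]
      linarith [h x y hx hy]
    have hna : ‖a‖ ≤ 5 / 4 := by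
      have := norm_sub_norm_le a w
      rw [norm_sub_rev] at this
      linarith
    -- The lattice term is at most `t / 4`; the two error terms cost `5/16 + 1/4 = 9/16` of `‖T‖`,
    -- which is absorbed on the left.
    have e : inner ℝ w (T v) = inner ℝ a (T b) + inner ℝ a (T (v - b)) + inner ℝ (w - a) (T v) := by
      rw [map_sub, inner_sub_right, inner_sub_left]; ring
    have i1 : inner ℝ a (T (v - b)) ≤ 5 / 4 * (‖T‖ * (1 / 4)) :=
      (real_inner_le_norm _ _).trans (mul_le_mul hna ((T.le_opNorm _).trans (by gcongr))
        (norm_nonneg _) (by norm_num))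
    have i2 : inner ℝ (w - a) (T v) ≤ 1 / 4 * (‖T‖ * 1) :=
      (real_inner_le_norm _ _).trans (mul_le_mul hx' ((T.le_opNorm _).trans (by rw [hv]))
        (norm_nonneg _) (by norm_num))
    rw [← hwv, e]
    linarith
  linarith [norm_nonneg T]

/-- Subgaussian moment bound: the sum over signs factors into hyperbolic cosines, and `cosh s ≤ exp
(s ^ 2 / 2)`. -/
theorem sum_signs_exp_le {ι : Type*} [Fintype ι] [DecidableEq ι] (s : ι → ℝ) :
    ∑ ε : ι → ℤˣ, Real.exp (∑ k, s k * ((ε k : ℤ) : ℝ)) ≤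
      2 ^ Fintype.card ι * Real.exp ((∑ k, s k ^ 2) / 2) := by
  have h : ∑ ε : ι → ℤˣ, Real.exp (∑ k, s k * ((ε k : ℤ) : ℝ)) = ∏ k, (2 * Real.cosh (s k)) := by
    simp_rw [Real.exp_sum]
    rw [← Fintype.prod_sum (fun k (e : ℤˣ) => Real.exp (s k * ((e : ℤ) : ℝ)))]
    refine Finset.prod_congr rfl fun k _ => ?_
    have : (Finset.univ : Finset ℤˣ) = {1, -1} := by decide
    rw [this, Finset.sum_pair (by decide), Real.cosh_eq]
    simp
    ring
  rw [h, Finset.sum_div, Real.exp_sum, Finset.prod_mul_distrib]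
  simp only [Finset.prod_const, Finset.card_univ]
  gcongr with k
  exact Real.cosh_le_exp_half_sq _

theorem sum_int_exp_neg_sq_le (N : ℕ) :
    ∑ k ∈ Finset.Icc (-(N : ℤ)) N, Real.exp (-(k : ℝ) ^ 2) ≤ 3 := by
  -- The correction `2 * (1/2) ^ N` makes the induction close: the new pair `±(m + 1)` adds at most
  -- `(1/2) ^ m`.
  have h : ∀ N : ℕ, ∑ k ∈ Finset.Icc (-(N : ℤ)) N, Real.exp (-(k : ℝ) ^ 2) ≤ 3 - 2 * (1/2) ^ N := by
    intro N
    induction N with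
    | zero => simp; norm_num
    | succ m ih =>
      have e : Finset.Icc (-((m + 1 : ℕ) : ℤ)) (m + 1 : ℕ) =
          insert (-((m + 1 : ℕ) : ℤ)) (insert ((m + 1 : ℕ) : ℤ) (Finset.Icc (-(m : ℤ)) m)) := by
        ext k; simp; omega
      rw [e, Finset.sum_insert (by simp; omega), Finset.sum_insert (by simp)]
      have b : Real.exp (-((m + 1 : ℕ) : ℝ) ^ 2) ≤ (1 / 2) ^ (m + 1) := by
        have h1 : Real.exp (-1) ≤ 1 / 2 := by
          have := Real.exp_one_gt_d9
          rw [Real.exp_neg, one_div]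
          exact inv_anti₀ (by norm_num) (by linarith)
        calc Real.exp (-((m + 1 : ℕ) : ℝ) ^ 2) ≤ Real.exp (((m + 1 : ℕ) : ℝ) * (-1)) := by
              apply Real.exp_le_exp.2
              push_cast
              nlinarith
          _ = Real.exp (-1) ^ (m + 1) := Real.exp_nat_mul _ _
          _ ≤ _ := by gcongr
      have e2 : (((-((m + 1 : ℕ) : ℤ)) : ℤ) : ℝ) ^ 2 = ((m + 1 : ℕ) : ℝ) ^ 2 := by push_cast; ring
      have e3 : (1 / 2 : ℝ) ^ (m + 1) = (1 / 2) ^ m / 2 := by rw [pow_succ]; ring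
      rw [e2, Int.cast_natCast]
      linarith
  have := h N
  have h2 : (0 : ℝ) ≤ (1 / 2) ^ N := by positivity
  linarith

/-- Lattice points in a ball are counted with a Gaussian weight: `exp (7n - ∑ x i ^ 2)` is at least
`1` on the ball, and its sum over a box factors into at most `exp (7n) * 3 ^ n`. -/
theorem exists_int_net (n : ℕ) : ∃ S : Finset (Fin n → ℤ),
    (∀ x, x ∈ S ↔ ∑ i, (x i : ℝ) ^ 2 ≤ 7 * n) ∧ (S.card : ℝ) ≤ Real.exp (9 * n) := by
  classical
  set B := Fintype.piFinset (fun _ : Fin n => Finset.Icc (-((7 * n : ℕ) : ℤ)) (7 * n : ℕ)) with hB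
  refine ⟨B.filter (fun x => ∑ i, (x i : ℝ) ^ 2 ≤ 7 * n), fun x => ?_, ?_⟩
  · rw [Finset.mem_filter, and_iff_right_iff_imp]
    intro hx
    rw [hB, Fintype.mem_piFinset]
    intro i
    have h1 : (x i : ℝ) ^ 2 ≤ 7 * n :=
      (Finset.single_le_sum (f := fun i => (x i : ℝ) ^ 2) (fun i _ => sq_nonneg _)
        (Finset.mem_univ i)).trans hx
    have h2 : (x i) ^ 2 ≤ 7 * (n : ℤ) := by exact_mod_cast h1
    rw [Finset.mem_Icc]
    push_cast
    constructor <;> nlinarith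
  · calc ((B.filter (fun x => ∑ i, (x i : ℝ) ^ 2 ≤ 7 * n)).card : ℝ)
        = ∑ x ∈ B.filter (fun x => ∑ i, (x i : ℝ) ^ 2 ≤ 7 * n), (1 : ℝ) := by simp
      _ ≤ ∑ x ∈ B.filter (fun x => ∑ i, (x i : ℝ) ^ 2 ≤ 7 * n),
            Real.exp (7 * n) * ∏ i, Real.exp (-(x i : ℝ) ^ 2) := by
          refine Finset.sum_le_sum fun x hx => ?_
          rw [← Real.exp_sum, ← Real.exp_add]
          apply Real.one_le_exp
          simp only [Finset.sum_neg_distrib]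
          linarith [(Finset.mem_filter.1 hx).2]
      _ ≤ ∑ x ∈ B, Real.exp (7 * n) * ∏ i, Real.exp (-(x i : ℝ) ^ 2) :=
          Finset.sum_le_sum_of_subset_of_nonneg (Finset.filter_subset _ _)
            fun _ _ _ => by positivity
      _ = Real.exp (7 * n) * (∑ k ∈ Finset.Icc (-((7 * n : ℕ) : ℤ)) (7 * n : ℕ),
            Real.exp (-(k : ℝ) ^ 2)) ^ n := by
          rw [← Finset.mul_sum, hB, ← Finset.prod_univ_sum
            (fun _ : Fin n => Finset.Icc (-((7 * n : ℕ) : ℤ)) (7 * n : ℕ))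
            (fun _ k => Real.exp (-(k : ℝ) ^ 2))]
          simp
      _ ≤ Real.exp (7 * n) * Real.exp 2 ^ n := by
          have := Real.exp_one_gt_d9
          have h2 : (3 : ℝ) ≤ Real.exp 2 := by
            have := Real.add_one_le_exp (2 : ℝ)
            linarith
          gcongr
          exact (sum_int_exp_neg_sq_le _).trans h2
      _ = Real.exp (9 * n) := by
          rw [← Real.exp_nat_mul, ← Real.exp_add]
          congr 1; ring

/-- The normalised real matrix with a given pattern of signs. -/
noncomputable def signMat {n : ℕ} (ε : Fin n × Fin n → ℤˣ) : Matrix (Fin n) (Fin n) ℝ :=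
  Matrix.of fun i j => ((ε (i, j) : ℤ) : ℝ) / √n

/-- Chernoff bound over pairs of net points. The exponents combine as `-50 + 25 + 9 + 9 = -7` per
unit of `n`. The extra factor `n` on the left pays later for the trivial bound `n` on the norm of a
product of two sign matrices. -/
theorem card_norm_signMat_gt_le {n : ℕ} (hn : 1 ≤ n) :
    ((Finset.univ.filter (fun ε : Fin n × Fin n → ℤˣ => 50 < ‖signMat ε‖)).card : ℝ) * n ≤
      2 ^ (n * n) * (1 / 20) := by
  classical
  have hn' : (1 : ℝ) ≤ n := by exact_mod_cast hn
  have hs : 0 < √(n : ℝ) := Real.sqrt_pos.2 (by linarith)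
  have hss : √(n : ℝ) * √n = n := Real.mul_self_sqrt (by linarith)
  obtain ⟨S, hS, hc⟩ := exists_int_net n
  -- If the norm exceeds `50`, some pair in the net has bilinear form above `50 * n`, and its
  -- exponential term alone is at least `1`.
  have step : ∀ ε ∈ Finset.univ.filter (fun ε : Fin n × Fin n → ℤˣ => 50 < ‖signMat ε‖),
      (1 : ℝ) ≤ ∑ p ∈ S ×ˢ S, Real.exp (-(50 * n)) *
        Real.exp (∑ k : Fin n × Fin n, ((p.1 k.1 : ℝ) * p.2 k.2 / √n) * ((ε k : ℤ) : ℝ)) := by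
    intro ε hε
    have hε := (Finset.mem_filter.1 hε).2
    by_contra hlt
    refine absurd (norm_le_of_int_bilin_le hn (signMat ε) 50 fun x y hx hy => ?_) (not_le.2 hε)
    by_contra hgt
    apply hlt
    have hm : (x, y) ∈ S ×ˢ S := Finset.mk_mem_product ((hS x).2 hx) ((hS y).2 hy)
    refine le_trans ?_ (Finset.single_le_sum (fun p _ => by positivity) hm)
    rw [← Real.exp_add]
    apply Real.one_le_exp
    rw [Fintype.sum_prod_type]
    have : ∑ i, ∑ j, ((x i : ℝ) * y j / √n) * ((ε (i, j) : ℤ) : ℝ)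
        = ∑ i, ∑ j, (x i : ℝ) * signMat ε i j * y j := by
      refine Finset.sum_congr rfl fun i _ => Finset.sum_congr rfl fun j _ => ?_
      simp only [signMat, Matrix.of_apply]; ring
    simp only [this]
    linarith
  have mgf : ∀ p ∈ S ×ˢ S, ∑ ε : Fin n × Fin n → ℤˣ, Real.exp (-(50 * n)) *
        Real.exp (∑ k : Fin n × Fin n, ((p.1 k.1 : ℝ) * p.2 k.2 / √n) * ((ε k : ℤ) : ℝ))
      ≤ 2 ^ (n * n) * Real.exp (-(25 * n)) := by
    intro p hp
    rw [← Finset.mul_sum]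
    have h1 := (hS _).1 (Finset.mem_product.1 hp).1
    have h2 := (hS _).1 (Finset.mem_product.1 hp).2
    have e : ∑ k : Fin n × Fin n, ((p.1 k.1 : ℝ) * p.2 k.2 / √n) ^ 2 ≤ 49 * n := by
      have : ∑ k : Fin n × Fin n, ((p.1 k.1 : ℝ) * p.2 k.2 / √n) ^ 2
          = (∑ i, (p.1 i : ℝ) ^ 2) * (∑ i, (p.2 i : ℝ) ^ 2) / n := by
        rw [Finset.sum_mul_sum, Fintype.sum_prod_type, Finset.sum_div]
        refine Finset.sum_congr rfl fun i _ => ?_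
        rw [Finset.sum_div]
        refine Finset.sum_congr rfl fun j _ => ?_
        rw [div_pow, mul_pow, Real.sq_sqrt (by linarith)]
      rw [this, div_le_iff₀ (by linarith)]
      calc _ ≤ (7 * n : ℝ) * (7 * n) := by gcongr
        _ = _ := by ring
    calc _ ≤ Real.exp (-(50 * n)) * (2 ^ Fintype.card (Fin n × Fin n) * Real.exp (25 * n)) := by
          gcongr
          refine (sum_signs_exp_le _).trans ?_
          gcongr
          linarith
      _ = _ := by
          rw [mul_left_comm, ← Real.exp_add, Fintype.card_prod, Fintype.card_fin]
          congr 2; ring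
  have hcard : ((Finset.univ.filter (fun ε : Fin n × Fin n → ℤˣ => 50 < ‖signMat ε‖)).card : ℝ) ≤
      2 ^ (n * n) * Real.exp (-(7 * n)) := by
    calc _ = ∑ ε ∈ Finset.univ.filter (fun ε : Fin n × Fin n → ℤˣ => 50 < ‖signMat ε‖), (1 : ℝ) := by
          simp
      _ ≤ _ := Finset.sum_le_sum step
      _ ≤ ∑ ε : Fin n × Fin n → ℤˣ, ∑ p ∈ S ×ˢ S, Real.exp (-(50 * n)) *
        Real.exp (∑ k : Fin n × Fin n, ((p.1 k.1 : ℝ) * p.2 k.2 / √n) * ((ε k : ℤ) : ℝ)) :=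
          Finset.sum_le_sum_of_subset_of_nonneg (Finset.filter_subset _ _)
            fun _ _ _ => by positivity
      _ ≤ ∑ p ∈ S ×ˢ S, 2 ^ (n * n) * Real.exp (-(25 * n)) := by
          rw [Finset.sum_comm]
          exact Finset.sum_le_sum mgf
      _ = (S.card : ℝ) * S.card * (2 ^ (n * n) * Real.exp (-(25 * n))) := by simp
      _ ≤ Real.exp (9 * n) * Real.exp (9 * n) * (2 ^ (n * n) * Real.exp (-(25 * n))) := by gcongr
      _ = _ := by
          rw [mul_left_comm, ← Real.exp_add, ← Real.exp_add]
          congr 2; ring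
  have hexp : Real.exp (-(7 * n)) * n ≤ 1 / 20 := by
    have h1 : (n : ℝ) ≤ Real.exp n := by linarith [Real.add_one_le_exp (n : ℝ)]
    calc Real.exp (-(7 * n)) * n ≤ Real.exp (-(7 * n)) * Real.exp n := by gcongr
      _ = Real.exp (-(6 * n)) := by rw [← Real.exp_add]; congr 1; ring
      _ ≤ Real.exp (-6) := Real.exp_le_exp.2 (by linarith)
      _ ≤ 1 / 20 := by
          rw [Real.exp_neg, one_div]
          apply inv_anti₀ (by norm_num)
          have h2 : (27 / 10 : ℝ) ≤ Real.exp 1 := by linarith [Real.exp_one_gt_d9]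
          calc (20 : ℝ) ≤ (27 / 10) ^ 6 := by norm_num
            _ ≤ Real.exp 1 ^ 6 := by gcongr
            _ = Real.exp 6 := by rw [← Real.exp_nat_mul]; norm_num
  calc _ ≤ 2 ^ (n * n) * Real.exp (-(7 * n)) * n := by gcongr
    _ = 2 ^ (n * n) * (Real.exp (-(7 * n)) * n) := by ring
    _ ≤ _ := by gcongr

/-! ### Signs of isotropic random vectors and Grothendieck's identity. -/

open MeasureTheory in
/-- A probability measure on a real inner product space that is invariant under linear isometries
and does not charge hyperplanes. -/
structure IsIsotropic {E : Type*} [NormedAddCommGroup E] [InnerProductSpace ℝ E]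
    [MeasurableSpace E] (μ : Measure E) : Prop where
  isProb : IsProbabilityMeasure μ
  preserving : ∀ f : E ≃ₗᵢ[ℝ] E, MeasurePreserving f μ μ
  hyperplane : ∀ v : E, v ≠ 0 → μ {G | inner ℝ v G = 0} = 0

instance : DiscreteMeasurableSpace ℤˣ where
  forall_measurableSet s :=
    ⟨Units.val '' s, MeasurableSet.of_discrete, Set.preimage_image_eq s Units.val_injective⟩

/-- The sign of a real number, as a unit of `ℤ`; the sign of `0` is `1`. -/
noncomputable def unitSign (t : ℝ) : ℤˣ := if 0 ≤ t then 1 else -1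

theorem unitSign_neg {t : ℝ} (ht : t ≠ 0) : unitSign (-t) = -unitSign t := by
  unfold unitSign
  rcases lt_or_gt_of_ne ht with h | h
  · rw [if_pos (by linarith), if_neg (by linarith), neg_neg]
  · rw [if_neg (by linarith), if_pos h.le]

theorem unitSign_eq_of_combination {p q r α β γ : ℝ} (hγ : 0 < γ) (hα : 0 < α) (hβ : 0 < β)
    (h : γ * r = β * p + α * q) (hpq : unitSign p = unitSign q) : unitSign p = unitSign r := by
  unfold unitSign at *
  by_cases hp : 0 ≤ p <;> by_cases hq : 0 ≤ q <;> simp only [hp, hq, if_true, if_false] at hpq ⊢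
  · rw [if_pos]
    have : 0 ≤ γ * r := by rw [h]; positivity
    exact nonneg_of_mul_nonneg_right this hγ
  · exact absurd hpq (by decide)
  · exact absurd hpq (by decide)
  · rw [if_neg]
    push Not at hp hq ⊢
    have : γ * r < 0 := by
      rw [h]
      linarith [mul_neg_of_pos_of_neg hβ hp, mul_neg_of_pos_of_neg hα hq]
    by_contra hr
    push Not at hr
    linarith [mul_nonneg hγ.le hr]

theorem units_eq_of_ne_of_ne {a b c : ℤˣ} : a ≠ b → b ≠ c → a = c := by
  revert a b c; decide

theorem measurable_unitSign : Measurable unitSign :=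
  Measurable.ite measurableSet_Ici measurable_const measurable_const

open MeasureTheory in
theorem IsIsotropic.ae_inner_ne_zero {E : Type*} [NormedAddCommGroup E] [InnerProductSpace ℝ E]
    [MeasurableSpace E] {μ : Measure E} (hμ : IsIsotropic μ) {v : E} (hv : v ≠ 0) :
    ∀ᵐ G ∂μ, inner ℝ v G ≠ 0 := by
  rw [ae_iff]
  simpa using hμ.hyperplane v hv

section Isotropic

open MeasureTheory

variable {E : Type*} [NormedAddCommGroup E] [InnerProductSpace ℝ E] [MeasurableSpace E]
  [BorelSpace E]

theorem exists_isIsotropic (E : Type*) [NormedAddCommGroup E] [InnerProductSpace ℝ E]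
    [MeasurableSpace E] [BorelSpace E] [FiniteDimensional ℝ E] :
    ∃ μ : Measure E, IsIsotropic μ := by
  -- The uniform law on the unit ball serves as well as a Gaussian, since only the direction of `G`
  -- affects the signs.
  refine ⟨(volume (Metric.ball (0 : E) 1))⁻¹ • volume.restrict (Metric.ball (0 : E) 1),
    ?_, ?_, ?_⟩
  · exact ProbabilityTheory.cond_isProbabilityMeasure_of_finite
      (Metric.measure_ball_pos _ _ one_pos).ne' measure_ball_lt_top.ne
  · intro f
    have h := f.measurePreserving.restrict_preimage (s := Metric.ball (0 : E) 1)
      Metric.isOpen_ball.measurableSet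
    rw [LinearIsometryEquiv.preimage_ball, map_zero] at h
    exact h.smul_measure _
  · intro v hv
    have h : volume ((LinearMap.ker (innerSL ℝ v : E →ₗ[ℝ] ℝ) : Submodule ℝ E) : Set E) = 0 := by
      refine Measure.addHaar_submodule _ _ fun h => hv ?_
      have : v ∈ LinearMap.ker (innerSL ℝ v : E →ₗ[ℝ] ℝ) := h ▸ Submodule.mem_top
      simpa using this
    have h' : volume.restrict (Metric.ball (0 : E) 1) {G : E | inner ℝ v G = 0} = 0 :=
      Measure.restrict_le_self.absolutelyContinuous (by
        convert h using 2
        ext G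
        simp)
    simp [h']

variable {μ : Measure E}

theorem measurable_unitSign_inner (v : E) : Measurable fun G : E => unitSign (inner ℝ v G) :=
  measurable_unitSign.comp (continuous_const.inner continuous_id).measurable

/-- The signs of the coordinates along a finite orthonormal family are independent and uniform. -/
theorem IsIsotropic.integral_signs (hμ : IsIsotropic μ) {ι : Type*} [Fintype ι] [DecidableEq ι]
    {Y : ι → E} (hY : Orthonormal ℝ Y) (F : (ι → ℤˣ) → ℝ) :
    ∫ G, F (fun i => unitSign (inner ℝ (Y i) G)) ∂μ = (∑ ε, F ε) / 2 ^ Fintype.card ι := by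
  have := hμ.isProb
  set s : E → ι → ℤˣ := fun G i => unitSign (inner ℝ (Y i) G) with hs
  have hsm : Measurable s := measurable_pi_lambda _ fun i => measurable_unitSign_inner (Y i)
  have hint : ∀ F : (ι → ℤˣ) → ℝ, Integrable (fun G => F (s G)) μ := fun F =>
    (Integrable.of_finite (μ := μ.map s) (f := F)).comp_measurable hsm
  -- Reflecting in the hyperplane orthogonal to `Y i` preserves `μ` and flips the `i`-th sign alone,
  -- almost everywhere. Such flips generate the whole sign group, so the law of `s` is translation
  -- invariant, hence uniform.
  have hflip : ∀ (i : ι) (F : (ι → ℤˣ) → ℝ),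
      ∫ G, F (Pi.mulSingle i (-1) * s G) ∂μ = ∫ G, F (s G) ∂μ := by
    intro i F
    have h1 : (∀ᵐ G ∂μ, F (Pi.mulSingle i (-1) * s G) =
        F (s ((Submodule.span ℝ {Y i})ᗮ.reflection G))) := by
      filter_upwards [hμ.ae_inner_ne_zero (hY.ne_zero i)] with G hG
      congr 1
      funext k
      have hk : inner ℝ (Y k) ((Submodule.span ℝ {Y i})ᗮ.reflection G) =
          inner ℝ ((Submodule.span ℝ {Y i})ᗮ.reflection (Y k)) G := by
        rw [← LinearIsometryEquiv.inner_map_map ((Submodule.span ℝ {Y i})ᗮ.reflection) (Y k),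
          Submodule.reflection_reflection]
      simp only [hs, Pi.mul_apply, hk]
      by_cases hki : k = i
      · subst hki
        rw [Submodule.reflection_orthogonalComplement_singleton_eq_neg, inner_neg_left,
          unitSign_neg hG]
        simp
      · rw [Submodule.reflection_mem_subspace_eq_self, Pi.mulSingle_eq_of_ne hki, one_mul]
        rw [Submodule.mem_orthogonal_singleton_iff_inner_right]
        exact hY.2 (Ne.symm hki)
    rw [integral_congr_ae h1]
    exact (hμ.preserving _).integral_comp
      ((Submodule.span ℝ {Y i})ᗮ.reflection).toHomeomorph.measurableEmbedding
      (fun G => F (s G))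
  have hall : ∀ (τ : ι → ℤˣ), ∀ F : (ι → ℤˣ) → ℝ, ∫ G, F (τ * s G) ∂μ = ∫ G, F (s G) ∂μ := by
    intro τ
    rw [← Finset.univ_prod_mulSingle τ]
    refine Finset.prod_induction _ (fun τ => ∀ F : (ι → ℤˣ) → ℝ,
      ∫ G, F (τ * s G) ∂μ = ∫ G, F (s G) ∂μ) ?_ ?_ ?_
    · intro a b ha hb F
      simp_rw [mul_assoc]
      exact (hb (fun x => F (a * x))).trans (ha F)
    · intro F
      simp
    · intro i _ F
      rcases Int.units_eq_one_or (τ i) with h | h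
      · simp [h]
      · rw [h]; exact hflip i F
  rw [eq_div_iff (by positivity)]
  calc (∫ G, F (s G) ∂μ) * 2 ^ Fintype.card ι = ∑ τ : ι → ℤˣ, ∫ G, F (τ * s G) ∂μ := by
        simp [hall, mul_comm]
    _ = ∫ G, ∑ τ : ι → ℤˣ, F (τ * s G) ∂μ :=
        (integral_finsetSum _ fun τ _ => hint fun x => F (τ * x)).symm
    _ = ∫ G, ∑ τ : ι → ℤˣ, F τ ∂μ := by
        congr 1
        funext G
        exact Fintype.sum_equiv (Equiv.mulRight (s G)) _ _ fun τ => rfl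
    _ = _ := by simp

theorem IsIsotropic.measureReal_isometry (hμ : IsIsotropic μ) (f : E ≃ₗᵢ[ℝ] E) (v w : E) :
    μ.real {G | unitSign (inner ℝ (f v) G) ≠ unitSign (inner ℝ (f w) G)} =
      μ.real {G | unitSign (inner ℝ v G) ≠ unitSign (inner ℝ w G)} := by
  have hm : MeasurableSet {G | unitSign (inner ℝ (f v) G) ≠ unitSign (inner ℝ (f w) G)} :=
    (measurableSet_eq_fun (measurable_unitSign_inner _) (measurable_unitSign_inner _)).compl
  rw [← (hμ.preserving f).measureReal_preimage hm.nullMeasurableSet]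
  simp

/-- Nonnegativity makes the additive function monotone, so `D a` is squeezed between consecutive
multiples of `D (L / N)`, with error `D L / N`. -/
theorem eq_mul_of_additive_on_Icc {D : ℝ → ℝ} {L : ℝ} (hL : 0 < L) (h0 : ∀ a, 0 ≤ D a)
    (hadd : ∀ a b, 0 ≤ a → 0 ≤ b → a + b ≤ L → D (a + b) = D a + D b) {a : ℝ} (ha : 0 ≤ a)
    (haL : a ≤ L) : D a = a / L * D L := by
  have hmono : ∀ a b, 0 ≤ a → a ≤ b → b ≤ L → D a ≤ D b := by
    intro a b ha hab hb
    have := hadd a (b - a) ha (by linarith) (by linarith)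
    rw [add_sub_cancel] at this
    linarith [h0 (b - a)]
  have hz : D 0 = 0 := by
    have := hadd 0 0 le_rfl le_rfl (by linarith)
    simp at this
    exact this
  have hmul : ∀ (m : ℕ) (d : ℝ), 0 ≤ d → m * d ≤ L → D (m * d) = m * D d := by
    intro m d hd
    induction m with
    | zero => intro _; simp [hz]
    | succ k ih =>
      intro h
      push_cast at h ⊢
      have e : ((k : ℝ) + 1) * d = k * d + d := by ring
      rw [e, hadd _ _ (by positivity) hd (by linarith), ih (by linarith)]
      ring
  have happ : ∀ N : ℕ, 1 ≤ N → |D a - a / L * D L| ≤ D L / N := by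
    intro N hN
    have hN' : (0 : ℝ) < N := by exact_mod_cast hN
    have hd : (0 : ℝ) ≤ L / N := by positivity
    have hDL : D L = N * D (L / N) := by
      have := hmul N (L / N) hd (by field_simp; exact le_rfl)
      rwa [mul_div_cancel₀ _ hN'.ne'] at this
    have hd0 := h0 (L / N)
    set m := ⌊a / (L / N)⌋₊ with hm
    have hpos : 0 < L / N := by positivity
    have h1 : (m : ℝ) * (L / N) ≤ a := by
      have := Nat.floor_le (show 0 ≤ a / (L / N) by positivity)
      rwa [le_div_iff₀ hpos] at this
    have h2 : a < (m + 1) * (L / N) := by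
      have := Nat.lt_floor_add_one (a / (L / N))
      rwa [div_lt_iff₀ hpos] at this
    have l1 : m * D (L / N) ≤ D a := by
      rw [← hmul m _ hd (h1.trans haL)]
      exact hmono _ _ (by positivity) h1 haL
    have u1 : D a ≤ (m + 1) * D (L / N) := by
      -- The upper multiple may overshoot `L`, beyond the range of additivity; then `D L = N * D (L
      -- / N)` suffices.
      by_cases hc : ((m : ℝ) + 1) * (L / N) ≤ L
      · have := hmul (m + 1) _ hd (by push_cast; exact hc)
        push_cast at this
        rw [← this]
        exact hmono _ _ ha h2.le hc
      · have : (N : ℝ) ≤ m + 1 := by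
          by_contra hlt
          apply hc
          rw [mul_div_assoc', div_le_iff₀ hN']
          nlinarith
        calc D a ≤ D L := hmono _ _ ha haL le_rfl
          _ = N * D (L / N) := hDL
          _ ≤ _ := by gcongr
    have h3 : a / L * D L = (a / (L / N)) * D (L / N) := by
      rw [hDL]; field_simp
    have h4 : D L / N = D (L / N) := by rw [hDL]; field_simp
    have h5 : (m : ℝ) ≤ a / (L / N) := by rwa [le_div_iff₀ hpos]
    have h6 : a / (L / N) ≤ m + 1 := by rw [div_le_iff₀ hpos]; exact h2.le
    rw [h3, h4, abs_le]
    constructor <;> nlinarith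
  by_contra hne
  have hpos : 0 < |D a - a / L * D L| := abs_pos.2 (sub_ne_zero.2 hne)
  obtain ⟨N, hN⟩ := exists_nat_gt (D L / |D a - a / L * D L|)
  have h1 := happ (N + 1) (by omega)
  rw [div_lt_iff₀ hpos] at hN
  rw [le_div_iff₀ (by positivity)] at h1
  push_cast at h1
  nlinarith

/-- The probability of a sign change along an arc depends only on its length and is additive, as
almost surely the sign changes at most once on a half circle. It equals `1` at angle `π`, so it is
linear. -/
theorem IsIsotropic.measureReal_unitSign_ne (hμ : IsIsotropic μ) {x x' : E} (hx : ‖x‖ = 1)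
    (hx' : ‖x'‖ = 1) (hxx' : inner ℝ x x' = 0) {φ : ℝ} (h0 : 0 ≤ φ) (hπ : φ ≤ Real.pi) :
    μ.real {G | unitSign (inner ℝ x G) ≠
      unitSign (inner ℝ (Real.cos φ • x + Real.sin φ • x') G)} = φ / Real.pi := by
  have := hμ.isProb
  set v : ℝ → E := fun φ => Real.cos φ • x + Real.sin φ • x' with hv
  have hv0 : v 0 = x := by simp [hv]
  have hvπ : v Real.pi = -x := by simp [hv]
  have hin : ∀ a b, inner ℝ (v a) (v b) = Real.cos (a - b) := by
    intro a b
    simp only [hv, inner_add_left, inner_add_right, real_inner_smul_left, real_inner_smul_right,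
      real_inner_self_eq_norm_sq, hx, hx', hxx', real_inner_comm x x', Real.cos_sub]
    ring
  have hnorm : ∀ a, ‖v a‖ ^ 2 = 1 := by
    intro a
    rw [← real_inner_self_eq_norm_sq, hin]; simp
  have hrefl : ∀ a b, (Submodule.span ℝ {v a}).reflection (v b) = v (2 * a - b) := by
    intro a b
    rw [Submodule.reflection_singleton_apply]
    simp only [RCLike.ofReal_real_eq_id, id, hnorm, hin, div_one]
    simp only [hv]
    have e1 : Real.cos (2 * a - b) = 2 * Real.cos (a - b) * Real.cos a - Real.cos b := by
      rw [show 2 * a - b = a + (a - b) by ring, show b = a - (a - b) by ring, Real.cos_add,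
        Real.cos_sub a (a - b)]
      ring_nf
    have e2 : Real.sin (2 * a - b) = 2 * Real.cos (a - b) * Real.sin a - Real.sin b := by
      rw [show 2 * a - b = a + (a - b) by ring, show b = a - (a - b) by ring, Real.sin_add,
        Real.sin_sub a (a - b)]
      ring_nf
    rw [e1, e2]
    module
  set D : ℝ → ℝ := fun φ => μ.real {G | unitSign (inner ℝ (v 0) G) ≠ unitSign (inner ℝ (v φ) G)}
    with hD
  -- Reflection in the bisecting line `v ((a + b) / 2)` carries `v a`, `v (a + b)` to `v b`, `v 0`.
  have hrot : ∀ a b, μ.real {G | unitSign (inner ℝ (v a) G) ≠ unitSign (inner ℝ (v (a + b)) G)}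
      = D b := by
    intro a b
    rw [← hμ.measureReal_isometry (Submodule.span ℝ {v ((a + b) / 2)}).reflection, hrefl, hrefl]
    simp only [hD]
    rw [show 2 * ((a + b) / 2) - a = b by ring, show 2 * ((a + b) / 2) - (a + b) = 0 by ring]
    simp only [ne_comm]
  -- An intermediate vector lies in the cone of the endpoints, so if the endpoint signs agree then
  -- its sign is the same.
  have hcomb : ∀ a b, Real.sin (a + b) • v a = Real.sin b • v 0 + Real.sin a • v (a + b) := by
    intro a b
    simp only [hv, Real.cos_zero, Real.sin_zero, one_smul, zero_smul, add_zero, smul_add, smul_smul]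
    have e1 : Real.sin (a + b) * Real.cos a = Real.sin b + Real.sin a * Real.cos (a + b) := by
      rw [Real.sin_add, Real.cos_add]
      linear_combination Real.sin b * Real.sin_sq_add_cos_sq a
    rw [e1]
    module
  have hadd : ∀ a b, 0 ≤ a → 0 ≤ b → a + b ≤ Real.pi → D (a + b) = D a + D b := by
    intro a b ha hb hab
    have hae : ∀ᵐ G ∂μ, unitSign (inner ℝ (v 0) G) = unitSign (inner ℝ (v (a + b)) G) →
        unitSign (inner ℝ (v 0) G) = unitSign (inner ℝ (v a) G) := by
      filter_upwards [hμ.ae_inner_ne_zero (v := v 0) (by rw [← norm_ne_zero_iff, hv0, hx]; simp)]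
        with G hG h
      rcases eq_or_lt_of_le hab with hab' | hab'
      · rw [hab', hvπ, ← hv0, inner_neg_left, unitSign_neg hG] at h
        exact absurd h (by generalize unitSign (inner ℝ (v 0) G) = z; revert z; decide)
      rcases eq_or_lt_of_le ha with rfl | ha'
      · rfl
      rcases eq_or_lt_of_le hb with rfl | hb'
      · rw [h, add_zero]
      have hsab : 0 < Real.sin (a + b) := Real.sin_pos_of_pos_of_lt_pi (by linarith) hab'
      have hsa : 0 < Real.sin a := Real.sin_pos_of_pos_of_lt_pi ha' (by linarith)
      have hsb : 0 < Real.sin b := Real.sin_pos_of_pos_of_lt_pi hb' (by linarith)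
      have hc := congrArg (fun z => inner ℝ z G) (hcomb a b)
      simp only [inner_add_left, real_inner_smul_left] at hc
      exact unitSign_eq_of_combination hsab hsa hsb hc h
    have hset : {G | unitSign (inner ℝ (v 0) G) ≠ unitSign (inner ℝ (v (a + b)) G)} =ᵐ[μ]
        ({G | unitSign (inner ℝ (v 0) G) ≠ unitSign (inner ℝ (v a) G)} ∪
          {G | unitSign (inner ℝ (v a) G) ≠ unitSign (inner ℝ (v (a + b)) G)} : Set E) := by
      filter_upwards [hae] with G hG
      refine propext ⟨fun h => ?_, fun h h' => ?_⟩
      · by_contra hc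
        exact h ((not_not.1 fun h1 => hc (Or.inl h1)).trans (not_not.1 fun h2 => hc (Or.inr h2)))
      · rcases h with h | h
        · exact h (hG h')
        · exact h ((hG h').symm.trans h')
    have hdis : AEDisjoint μ
        {G | unitSign (inner ℝ (v 0) G) ≠ unitSign (inner ℝ (v a) G)}
        {G | unitSign (inner ℝ (v a) G) ≠ unitSign (inner ℝ (v (a + b)) G)} := by
      refine measure_mono_null ?_ (ae_iff.1 hae)
      rintro G ⟨h1, h2⟩ h
      exact h1 (h (units_eq_of_ne_of_ne h1 h2))
    have hm : NullMeasurableSet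
        {G | unitSign (inner ℝ (v a) G) ≠ unitSign (inner ℝ (v (a + b)) G)} μ :=
      (measurableSet_eq_fun (measurable_unitSign_inner _)
        (measurable_unitSign_inner _)).compl.nullMeasurableSet
    rw [← hrot a b]
    exact (measureReal_congr hset).trans (measureReal_union₀ hm hdis)
  have hDπ : D Real.pi = 1 := by
    have h : {G | unitSign (inner ℝ (v 0) G) ≠ unitSign (inner ℝ (v Real.pi) G)} =ᵐ[μ] Set.univ := by
      filter_upwards [hμ.ae_inner_ne_zero (v := v 0) (by rw [← norm_ne_zero_iff, hv0, hx]; simp)]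
        with G hG
      refine propext ⟨fun _ => trivial, fun _ => ?_⟩
      change unitSign (inner ℝ (v 0) G) ≠ unitSign (inner ℝ (v Real.pi) G)
      rw [hvπ, ← hv0, inner_neg_left, unitSign_neg hG]
      generalize unitSign (inner ℝ (v 0) G) = z
      revert z; decide
    exact (measureReal_congr h).trans probReal_univ
  have := eq_mul_of_additive_on_Icc (D := D) Real.pi_pos (fun a => measureReal_nonneg) hadd h0 hπ
  rw [hDπ, mul_one] at this
  simpa [hD, hv0] using this

/-- Grothendieck's identity. -/
theorem IsIsotropic.integral_unitSign_mul (hμ : IsIsotropic μ) {x y : E} (hx : ‖x‖ = 1)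
    (hy : ‖y‖ = 1) :
    ∫ G, ((unitSign (inner ℝ x G) : ℤ) : ℝ) * ((unitSign (inner ℝ y G) : ℤ) : ℝ) ∂μ =
      2 / Real.pi * Real.arcsin (inner ℝ x y) := by
  have := hμ.isProb
  have hx0 : x ≠ 0 := by rw [← norm_ne_zero_iff, hx]; simp
  set S := {G | unitSign (inner ℝ x G) ≠ unitSign (inner ℝ y G)} with hS
  have hSm : MeasurableSet S :=
    (measurableSet_eq_fun (measurable_unitSign_inner _) (measurable_unitSign_inner _)).compl
  have hint : ∫ G, ((unitSign (inner ℝ x G) : ℤ) : ℝ) * ((unitSign (inner ℝ y G) : ℤ) : ℝ) ∂μ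
      = 1 - 2 * μ.real S := by
    have e : ∀ G, ((unitSign (inner ℝ x G) : ℤ) : ℝ) * ((unitSign (inner ℝ y G) : ℤ) : ℝ) =
        1 - S.indicator (fun _ => 2) G := by
      intro G
      by_cases hG : G ∈ S
      · rw [Set.indicator_of_mem hG]
        have hG' : unitSign (inner ℝ x G) ≠ unitSign (inner ℝ y G) := hG
        rcases Int.units_eq_one_or (unitSign (inner ℝ x G)) with h1 | h1 <;>
          rcases Int.units_eq_one_or (unitSign (inner ℝ y G)) with h2 | h2 <;>
          rw [h1, h2] at hG' ⊢ <;> first | exact absurd rfl hG' | norm_num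
      · rw [Set.indicator_of_notMem hG]
        have hG' : unitSign (inner ℝ x G) = unitSign (inner ℝ y G) := not_not.1 hG
        rw [hG']
        rcases Int.units_eq_one_or (unitSign (inner ℝ y G)) with h2 | h2 <;> rw [h2] <;> norm_num
    simp_rw [e]
    rw [integral_sub (integrable_const _) ((integrable_const _).indicator hSm),
      integral_indicator_const _ hSm]
    simp [mul_comm]
  rw [hint]
  set t := inner ℝ x y with ht
  have hts : |t| ≤ 1 := by
    have := abs_real_inner_le_norm x y
    rwa [hx, hy, one_mul] at this
  have hpi := Real.pi_pos
  -- For `t = ±1` the vectors are collinear and Gram–Schmidt gives no second direction `x'`.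
  by_cases h1 : t = 1
  · have hxy : x = y := (inner_eq_one_iff_of_norm_eq_one hx hy).1 h1
    have : S = ∅ := by rw [hS, hxy]; simp
    rw [this, h1, Real.arcsin_one]
    simp
  by_cases h2 : t = -1
  · have hxy : x = -y := (inner_eq_neg_one_iff_of_norm_eq_one hx hy).1 h2
    have hxy' : y = -x := by rw [hxy, neg_neg]
    have h : S =ᵐ[μ] Set.univ := by
      filter_upwards [hμ.ae_inner_ne_zero hx0] with G hG
      refine propext ⟨fun _ => trivial, fun _ => ?_⟩
      change unitSign (inner ℝ x G) ≠ unitSign (inner ℝ y G)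
      rw [hxy', inner_neg_left, unitSign_neg hG]
      generalize unitSign (inner ℝ x G) = z
      revert z; decide
    rw [measureReal_congr h, probReal_univ, h2, Real.arcsin_neg_one]
    field_simp
    ring
  have hlt : t ^ 2 < 1 := by
    rw [sq_lt_one_iff_abs_lt_one]
    refine lt_of_le_of_ne hts fun h => ?_
    rcases eq_or_eq_neg_of_abs_eq h with h | h
    exacts [h1 h, h2 h]
  have hr : 0 < √(1 - t ^ 2) := Real.sqrt_pos.2 (by linarith)
  have hr2 : √(1 - t ^ 2) ^ 2 = 1 - t ^ 2 := Real.sq_sqrt (by linarith)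
  set x' := (√(1 - t ^ 2))⁻¹ • (y - t • x) with hx'
  have hperp : inner ℝ x (y - t • x) = 0 := by
    rw [inner_sub_right, real_inner_smul_right, real_inner_self_eq_norm_sq, hx, ← ht]; ring
  have hxx' : inner ℝ x x' = 0 := by rw [hx', real_inner_smul_right, hperp, mul_zero]
  have hn : ‖y - t • x‖ ^ 2 = 1 - t ^ 2 := by
    rw [norm_sub_sq_real, real_inner_smul_right, norm_smul, hx, hy, real_inner_comm, ← ht]
    simp; ring
  have hnx' : ‖x'‖ = 1 := by
    rw [hx', norm_smul, norm_inv, Real.norm_eq_abs, abs_of_pos hr,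
      ← Real.sqrt_sq (norm_nonneg (y - t • x)), hn, inv_mul_cancel₀ hr.ne']
  have hyv : y = Real.cos (Real.arccos t) • x + Real.sin (Real.arccos t) • x' := by
    rw [Real.cos_arccos (abs_le.1 hts).1 (abs_le.1 hts).2, Real.sin_arccos, hx', smul_smul,
      mul_inv_cancel₀ hr.ne', one_smul]
    module
  have := hμ.measureReal_unitSign_ne hx hnx' hxx' (Real.arccos_nonneg t) (Real.arccos_le_pi t)
  rw [← hyv] at this
  rw [hS, this, Real.arccos_eq_pi_div_two_sub_arcsin]
  field_simp
  ring

end Isotropic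

/-- A coupling of two uniform families of signs whose cross correlations are the arcsines of the
inner products of two orthonormal families. -/
theorem exists_sign_coupling {E ι : Type*} [NormedAddCommGroup E] [InnerProductSpace ℝ E]
    [FiniteDimensional ℝ E] [Fintype ι] [DecidableEq ι] {Y X : ι → E} (hY : Orthonormal ℝ Y)
    (hX : Orthonormal ℝ X) :
    ∃ w : (ι → ℤˣ) → (ι → ℤˣ) → ℝ, (∀ β α, 0 ≤ w β α) ∧
      (∀ β, ∑ α, w β α = 1 / 2 ^ Fintype.card ι) ∧
      (∀ α, ∑ β, w β α = 1 / 2 ^ Fintype.card ι) ∧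
      ∀ i k, ∑ β, ∑ α, w β α * (((β i : ℤ) : ℝ) * ((α k : ℤ) : ℝ)) =
        2 / Real.pi * Real.arcsin (inner ℝ (Y i) (X k)) := by
  let _ : MeasurableSpace E := borel E
  have : BorelSpace E := ⟨rfl⟩
  obtain ⟨μ, hμ⟩ := exists_isIsotropic E
  have := hμ.isProb
  set s : E → (ι → ℤˣ) × (ι → ℤˣ) := fun G =>
    (fun i => unitSign (inner ℝ (Y i) G), fun i => unitSign (inner ℝ (X i) G)) with hs
  have hsm : Measurable s :=
    (measurable_pi_lambda _ fun i => measurable_unitSign_inner (Y i)).prodMk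
      (measurable_pi_lambda _ fun i => measurable_unitSign_inner (X i))
  have hsum : ∀ F : (ι → ℤˣ) × (ι → ℤˣ) → ℝ,
      ∑ p, (μ.map s).real {p} * F p = ∫ G, F (s G) ∂μ := by
    intro F
    have := MeasureTheory.integral_fintype
      (MeasureTheory.Integrable.of_finite (μ := μ.map s) (f := F))
    rw [MeasureTheory.integral_map hsm.aemeasurable
      (measurable_of_finite F).aestronglyMeasurable] at this
    simpa using this.symm
  refine ⟨fun β α => (μ.map s).real {(β, α)}, fun _ _ => MeasureTheory.measureReal_nonneg,
    fun β => ?_, fun α => ?_, fun i k => ?_⟩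
  · have h1 := hsum fun p => if p.1 = β then 1 else 0
    have h2 := hμ.integral_signs hY fun ε => if ε = β then (1 : ℝ) else 0
    rw [Fintype.sum_prod_type] at h1
    simp only [mul_ite, mul_one, mul_zero, Finset.sum_ite_irrel, Finset.sum_const_zero,
      Finset.sum_ite_eq', Finset.mem_univ, if_true] at h1 h2
    exact h1.trans h2
  · have h1 := hsum fun p => if p.2 = α then 1 else 0
    have h2 := hμ.integral_signs hX fun ε => if ε = α then (1 : ℝ) else 0
    rw [Fintype.sum_prod_type] at h1
    simp only [mul_ite, mul_one, mul_zero, Finset.sum_ite_eq', Finset.mem_univ, if_true] at h1 h2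
    exact h1.trans h2
  · have h1 := hsum fun p => ((p.1 i : ℤ) : ℝ) * ((p.2 k : ℤ) : ℝ)
    rw [Fintype.sum_prod_type] at h1
    rw [← hμ.integral_unitSign_mul (hY.1 i) (hX.1 k)]
    exact h1

/-! ### Linearising the arcsine; Schur's test and the dilation of a contraction. -/

/-- An error quadratic in `t` is what Schur's test can absorb, and the constant must stay below `1`
for the later iteration. With `t = sin s`, it follows from a cubic lower bound for `sin` and
Jordan's inequality. -/
theorem abs_arcsin_sub_le {t : ℝ} (ht : |t| ≤ 1) : |Real.arcsin t - t| ≤ 2 / 3 * t ^ 2 := by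
  have key : ∀ s : ℝ, 0 ≤ s → s ≤ Real.pi / 2 → |s - Real.sin s| ≤ 2 / 3 * Real.sin s ^ 2 := by
    intro s h0 h1
    have hpi := Real.pi_lt_d2
    have hpi0 := Real.pi_pos
    rw [abs_of_nonneg (by linarith [Real.sin_le h0])]
    have h2 := Real.sin_ge_sub_cube h0
    have h3 := Real.mul_le_sin h0 h1
    have h4 : (2 / 3.15 * s) ^ 2 ≤ Real.sin s ^ 2 := by
      have : 2 / 3.15 * s ≤ 2 / Real.pi * s := by gcongr
      gcongr
      exact this.trans h3
    have h5 : s ≤ 1.575 := by linarith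
    have h6 : s ^ 2 * s ≤ s ^ 2 * 1.575 := by gcongr
    nlinarith [sq_nonneg s]
  have hs := Real.sin_arcsin (abs_le.1 ht).1 (abs_le.1 ht).2
  rcases le_total 0 t with h | h
  · have := key (Real.arcsin t) (Real.arcsin_nonneg.2 h) (Real.arcsin_le_pi_div_two t)
    rwa [hs] at this
  · have := key (Real.arcsin (-t)) (Real.arcsin_nonneg.2 (by linarith))
      (Real.arcsin_le_pi_div_two _)
    rw [Real.arcsin_neg, Real.sin_neg, hs, neg_sq] at this
    calc |Real.arcsin t - t| = |-Real.arcsin t - -t| := by rw [← abs_neg]; congr 1; ring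
      _ ≤ _ := this

section NormBounds

variable {𝕜 : Type*} [RCLike 𝕜] {m : Type*} [Fintype m] [DecidableEq m]

theorem Matrix.l2_opNorm_le_of_sum_sq_le {M : Matrix m m 𝕜} {c : ℝ} (hc : 0 ≤ c)
    (h : ∀ v : m → 𝕜, ∑ i, ‖(M.mulVec v) i‖ ^ 2 ≤ c ^ 2 * ∑ i, ‖v i‖ ^ 2) : ‖M‖ ≤ c := by
  rw [← Matrix.l2_opNorm_toEuclideanCLM]
  refine ContinuousLinearMap.opNorm_le_bound _ hc fun v => ?_
  refine abs_le_of_sq_le_sq' ?_ (by positivity) |>.2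
  rw [mul_pow, EuclideanSpace.norm_sq_eq, EuclideanSpace.norm_sq_eq]
  exact h v.ofLp

theorem Matrix.sum_sq_mulVec_le {M : Matrix m m 𝕜} {c : ℝ} (h : ‖M‖ ≤ c) (v : m → 𝕜) :
    ∑ i, ‖(M.mulVec v) i‖ ^ 2 ≤ c ^ 2 * ∑ i, ‖v i‖ ^ 2 := by
  have h1 := Matrix.l2_opNorm_mulVec M (WithLp.toLp 2 v)
  have h2 : ‖WithLp.toLp 2 (M.mulVec v)‖ ≤ c * ‖WithLp.toLp 2 v‖ := h1.trans (by gcongr)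
  have h3 := pow_le_pow_left₀ (norm_nonneg _) h2 2
  rwa [mul_pow, EuclideanSpace.norm_sq_eq, EuclideanSpace.norm_sq_eq] at h3

theorem Matrix.sum_sq_col_le {M : Matrix m m 𝕜} {c : ℝ} (h : ‖M‖ ≤ c) (k : m) :
    ∑ i, ‖M i k‖ ^ 2 ≤ c ^ 2 := by
  have := Matrix.sum_sq_mulVec_le h (Pi.single k 1)
  simpa [Pi.single_apply, apply_ite (fun x : 𝕜 => ‖x‖)] using this

theorem Matrix.sum_sq_row_le {M : Matrix m m 𝕜} {c : ℝ} (h : ‖M‖ ≤ c) (i : m) :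
    ∑ k, ‖M i k‖ ^ 2 ≤ c ^ 2 := by
  rw [← Matrix.l2_opNorm_conjTranspose] at h
  simpa using Matrix.sum_sq_col_le h i

theorem Matrix.l2_opNorm_le_frobenius {M : Matrix m m 𝕜} {c : ℝ} (hc : 0 ≤ c)
    (h : ∑ i, ∑ j, ‖M i j‖ ^ 2 ≤ c ^ 2) : ‖M‖ ≤ c := by
  refine Matrix.l2_opNorm_le_of_sum_sq_le hc fun v => ?_
  calc ∑ i, ‖(M.mulVec v) i‖ ^ 2 ≤ ∑ i, (∑ j, ‖M i j‖ ^ 2) * ∑ j, ‖v j‖ ^ 2 := by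
        refine Finset.sum_le_sum fun i _ => ?_
        refine le_trans ?_ (Finset.sum_mul_sq_le_sq_mul_sq _ _ _)
        gcongr
        exact (norm_sum_le _ _).trans (by simp)
    _ ≤ _ := by
        rw [← Finset.sum_mul]
        gcongr

/-- Schur's test for a matrix whose entries are dominated by the squares of the entries of a
contraction. -/
theorem Matrix.l2_opNorm_le_of_abs_le_sq {u R : Matrix m m ℝ} {c : ℝ} (hc : 0 ≤ c) (hu : ‖u‖ ≤ 1)
    (h : ∀ i k, |R i k| ≤ c * u i k ^ 2) : ‖R‖ ≤ c := by
  -- Rows and columns of a contraction have Euclidean norm at most `1`, so the matrix of squares is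
  -- doubly substochastic.
  have hrow : ∀ i, ∑ k, u i k ^ 2 ≤ 1 := fun i => by
    simpa using Matrix.sum_sq_row_le hu i
  have hcol : ∀ k, ∑ i, u i k ^ 2 ≤ 1 := fun k => by
    simpa using Matrix.sum_sq_col_le hu k
  refine Matrix.l2_opNorm_le_of_sum_sq_le hc fun v => ?_
  calc ∑ i, ‖(R.mulVec v) i‖ ^ 2 ≤ ∑ i, c ^ 2 * ∑ k, u i k ^ 2 * v k ^ 2 := by
        refine Finset.sum_le_sum fun i _ => ?_
        have h1 : ‖(R.mulVec v) i‖ ≤ c * ∑ k, |u i k| * |u i k * v k| := by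
          rw [Matrix.mulVec, dotProduct, Finset.mul_sum]
          refine (norm_sum_le _ _).trans (Finset.sum_le_sum fun k _ => ?_)
          rw [norm_mul, Real.norm_eq_abs, Real.norm_eq_abs, abs_mul, ← mul_assoc, ← mul_assoc]
          refine mul_le_mul_of_nonneg_right ?_ (abs_nonneg _)
          rw [mul_assoc, abs_mul_abs_self, ← sq]
          exact h i k
        have h2 : (∑ k, |u i k| * |u i k * v k|) ^ 2 ≤ ∑ k, u i k ^ 2 * v k ^ 2 := by
          refine (Finset.sum_mul_sq_le_sq_mul_sq _ _ _).trans ?_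
          simp only [sq_abs, mul_pow]
          exact mul_le_of_le_one_left (by positivity) (hrow i)
        calc ‖(R.mulVec v) i‖ ^ 2 ≤ (c * ∑ k, |u i k| * |u i k * v k|) ^ 2 := by gcongr
          _ ≤ _ := by rw [mul_pow]; gcongr
    _ = c ^ 2 * ∑ k, (∑ i, u i k ^ 2) * v k ^ 2 := by
        rw [← Finset.mul_sum, Finset.sum_comm]
        simp_rw [Finset.sum_mul]
    _ ≤ c ^ 2 * ∑ k, ‖v k‖ ^ 2 := by
        gcongr with k
        rw [Real.norm_eq_abs, sq_abs]
        exact mul_le_of_le_one_left (by positivity) (hcol k)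

/-- `B` is a factor of the positive defect `1 - u uᴴ`; the rows of the block matrix `[u | Bᴴ]` are
then orthonormal. -/
theorem Matrix.exists_dilation {u : Matrix m m ℝ} (hu : ‖u‖ ≤ 1) :
    ∃ B : Matrix m m ℝ, u * u.conjTranspose + B.conjTranspose * B = 1 := by
  have hpos : (1 - u * u.conjTranspose).PosSemidef := by
    refine Matrix.PosSemidef.of_dotProduct_mulVec_nonneg
      (Matrix.isHermitian_one.sub (Matrix.isHermitian_mul_conjTranspose_self u)) fun v => ?_
    have h := Matrix.sum_sq_mulVec_le (M := u.conjTranspose) (c := 1)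
      (by rwa [Matrix.l2_opNorm_conjTranspose]) v
    rw [Matrix.sub_mulVec, Matrix.one_mulVec, dotProduct_sub, ← Matrix.mulVec_mulVec,
      Matrix.dotProduct_mulVec, sub_nonneg, star_trivial, ← Matrix.mulVec_transpose,
      ← Matrix.conjTranspose_eq_transpose_of_trivial]
    simpa [dotProduct, ← sq] using h
  obtain ⟨B, hB⟩ := CStarAlgebra.nonneg_iff_eq_star_mul_self.1 (Matrix.nonneg_iff_posSemidef.2 hpos)
  refine ⟨B, ?_⟩
  rw [← Matrix.star_eq_conjTranspose B, ← hB, add_sub_cancel]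

end NormBounds

/-- With `W = [u | Bᴴ]`, `Y (i, j)` is row `i` of `W` tensored with `e_j`, and `X (j, k)` is the
`k`-th basis vector of the first block tensored with `e_j`. The tensor factor supplies `n`
orthogonal copies, so that all `n * n` signs in each matrix are independent. -/
theorem exists_orthonormal_families {n : ℕ} {u : Matrix (Fin n) (Fin n) ℝ} (hu : ‖u‖ ≤ 1) :
    ∃ Y X : Fin n × Fin n → EuclideanSpace ℝ ((Fin n ⊕ Fin n) × Fin n),
      Orthonormal ℝ Y ∧ Orthonormal ℝ X ∧ ∀ i j k, inner ℝ (Y (i, j)) (X (j, k)) = u i k := by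
  obtain ⟨B, hB⟩ := Matrix.exists_dilation hu
  set W : Matrix (Fin n) (Fin n ⊕ Fin n) ℝ :=
    Matrix.of fun i => Sum.elim (u i) (fun k => B k i) with hW
  have hWW : ∀ i i', ∑ p, W i p * W i' p = if i = i' then 1 else 0 := by
    intro i i'
    have := congrFun (congrFun hB i) i'
    rw [Matrix.one_apply] at this
    rw [← this, Fintype.sum_sum_type]
    simp [hW, Matrix.mul_apply]
  refine ⟨fun p => WithLp.toLp 2 fun q => if p.2 = q.2 then W p.1 q.1 else 0,
    fun p => EuclideanSpace.single (Sum.inl p.2, p.1) 1, ?_, ?_, ?_⟩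
  · rw [orthonormal_iff_ite]
    rintro ⟨i, j⟩ ⟨i', j'⟩
    rw [PiLp.inner_apply, Fintype.sum_prod_type]
    simp only [RCLike.inner_apply, conj_trivial, mul_ite, ite_mul, zero_mul, mul_zero,
      Finset.sum_ite_eq, Finset.mem_univ, if_true]
    by_cases hj : j = j'
    · subst hj
      simp only [if_true, Prod.mk.injEq, and_true]
      rw [← hWW]
      simp_rw [mul_comm]
    · simp [hj, Ne.symm hj]
  · rw [orthonormal_iff_ite]
    rintro ⟨j, k⟩ ⟨j', k'⟩
    simp [EuclideanSpace.inner_single_left, Prod.ext_iff, and_comm]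
  · intro i j k
    simp [EuclideanSpace.inner_single_right, hW]

/-- Reapply the approximation to the remainder rescaled by `q⁻¹`. The resulting geometric series
sums to `c / (1 - q)`, convexity keeps each partial sum in the multiple of `K`, and closedness gives
the limit. -/
theorem closedBall_subset_smul_of_approx {V : Type*} [NormedAddCommGroup V] [NormedSpace ℝ V]
    {K : Set V} (hK : Convex ℝ K) (hcl : IsClosed K) (h0 : (0 : V) ∈ K) {c q : ℝ} (hc : 0 < c)
    (hq0 : 0 ≤ q) (hq : q < 1)
    (h : ∀ u : V, ‖u‖ ≤ 1 → ∃ k ∈ K, ‖u - c • k‖ ≤ q) :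
    Metric.closedBall (0 : V) 1 ⊆ (c / (1 - q)) • K := by
  have hq1 : 0 < 1 - q := by linarith
  have happ : ∀ (N : ℕ) (u : V), ‖u‖ ≤ 1 → ∃ k ∈ K, ‖u - (c / (1 - q)) • k‖ ≤ q ^ N := by
    intro N
    induction N with
    | zero => intro u hu; exact ⟨0, h0, by simpa using hu⟩
    | succ N ih =>
      intro u hu
      obtain ⟨k, hk, hku⟩ := h u hu
      rcases eq_or_lt_of_le hq0 with rfl | hqp
      · exact ⟨k, hk, by simpa using hku⟩
      obtain ⟨k', hk', hke⟩ := ih (q⁻¹ • (u - c • k)) (by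
        rw [norm_smul, norm_inv, Real.norm_eq_abs, abs_of_pos hqp, inv_mul_le_iff₀ hqp, mul_one]
        exact hku)
      refine ⟨(1 - q) • k + q • k', hK hk hk' hq1.le hq0 (by ring), ?_⟩
      have e : u - (c / (1 - q)) • ((1 - q) • k + q • k') =
          q • (q⁻¹ • (u - c • k) - (c / (1 - q)) • k') := by
        rw [smul_add, smul_smul, smul_smul, div_mul_cancel₀ _ hq1.ne', smul_sub, smul_smul,
          mul_inv_cancel₀ hqp.ne', one_smul, smul_smul, mul_comm q (c / (1 - q))]
        abel
      rw [e, norm_smul, Real.norm_eq_abs, abs_of_pos hqp, pow_succ']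
      gcongr
  have hpos : 0 < c / (1 - q) := by positivity
  intro u hu
  rw [mem_closedBall_zero_iff] at hu
  have hcl' : IsClosed ((c / (1 - q)) • K) := hcl.smul_of_ne_zero hpos.ne'
  rw [← hcl'.closure_eq, Metric.mem_closure_iff]
  intro ε hε
  obtain ⟨N, hN⟩ := exists_pow_lt_of_lt_one hε hq
  obtain ⟨k, hk, hku⟩ := happ N u hu
  exact ⟨_, Set.smul_mem_smul_set hk, by rw [dist_eq_norm]; exact hku.trans_lt hN⟩

/-! ### The real unit ball inside the hull of sign products. -/

/-- Products of two real sign matrices of norm at most `50`. -/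
def signProducts (n : ℕ) : Set (Matrix (Fin n) (Fin n) ℝ) :=
  {M | ∃ β α : Fin n × Fin n → ℤˣ, ‖signMat β‖ ≤ 50 ∧ ‖signMat α‖ ≤ 50 ∧
    M = signMat β * signMat α}

theorem signProducts_finite (n : ℕ) : (signProducts n).Finite := by
  refine (Set.finite_range fun p : (Fin n × Fin n → ℤˣ) × (Fin n × Fin n → ℤˣ) =>
    signMat p.1 * signMat p.2).subset ?_
  rintro M ⟨β, α, _, _, rfl⟩
  exact ⟨(β, α), rfl⟩

theorem norm_signMat_le {n : ℕ} (hn : 1 ≤ n) (ε : Fin n × Fin n → ℤˣ) : ‖signMat ε‖ ≤ √n := by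
  have hn' : (1 : ℝ) ≤ n := by exact_mod_cast hn
  refine Matrix.l2_opNorm_le_frobenius (Real.sqrt_nonneg _) ?_
  rw [Real.sq_sqrt (by linarith)]
  have : ∀ i j, ‖signMat ε i j‖ ^ 2 = 1 / n := by
    intro i j
    rw [signMat, Matrix.of_apply, norm_div, div_pow, Real.norm_eq_abs, Real.norm_eq_abs, sq_abs,
      sq_abs, Real.sq_sqrt (by linarith)]
    rcases Int.units_eq_one_or (ε (i, j)) with h | h <;> rw [h] <;> norm_num
  simp_rw [this]
  simp
  field_simp
  exact le_rfl

theorem exists_norm_signMat_le {n : ℕ} (hn : 1 ≤ n) :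
    ∃ ε : Fin n × Fin n → ℤˣ, ‖signMat ε‖ ≤ 50 := by
  by_contra hne
  push Not at hne
  have h := card_norm_signMat_gt_le hn
  rw [Finset.filter_true_of_mem fun ε _ => hne ε] at h
  have hn' : (1 : ℝ) ≤ n := by exact_mod_cast hn
  have hp : (0 : ℝ) < 2 ^ (n * n) := by positivity
  simp at h
  nlinarith

theorem zero_mem_absConvexHull_signProducts {n : ℕ} (hn : 1 ≤ n) :
    (0 : Matrix (Fin n) (Fin n) ℝ) ∈ absConvexHull ℝ (signProducts n) := by
  obtain ⟨ε, hε⟩ := exists_norm_signMat_le hn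
  have : Nonempty (signProducts n) := ⟨⟨_, ε, ε, hε, hε, rfl⟩⟩
  exact zero_mem_absConvexHull

theorem exists_approx_signProducts {n : ℕ} (hn : 1 ≤ n) {u : Matrix (Fin n) (Fin n) ℝ}
    (hu : ‖u‖ ≤ 1) :
    ∃ k ∈ absConvexHull ℝ (signProducts n), ‖u - (Real.pi / 2) • k‖ ≤ 5 / 6 := by
  classical
  have hn' : (1 : ℝ) ≤ n := by exact_mod_cast hn
  have hss : √(n : ℝ) * √n = n := Real.mul_self_sqrt (by linarith)
  have hs0 := Real.sqrt_nonneg (n : ℝ)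
  have hpi := Real.pi_lt_d2
  have hpi0 := Real.pi_pos
  have h0 : (0 : Matrix (Fin n) (Fin n) ℝ) ∈ absConvexHull ℝ (signProducts n) :=
    zero_mem_absConvexHull_signProducts hn
  obtain ⟨Y, X, hY, hX, hYX⟩ := exists_orthonormal_families hu
  obtain ⟨w, hw0, hw1, hw2, hw⟩ := exists_sign_coupling hY hX
  rw [Fintype.card_prod, Fintype.card_fin] at hw1 hw2
  set bad := Finset.univ.filter (fun ε : Fin n × Fin n → ℤˣ => 50 < ‖signMat ε‖) with hbad
  have hbadc : (bad.card : ℝ) * n ≤ 2 ^ (n * n) * (1 / 20) := card_norm_signMat_gt_le hn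
  -- Bad outcomes are replaced by `0`, which lies in the hull, so the weights `w` still give a
  -- convex combination.
  set g : (Fin n × Fin n → ℤˣ) → (Fin n × Fin n → ℤˣ) → Matrix (Fin n) (Fin n) ℝ := fun β α =>
    if β ∈ bad ∨ α ∈ bad then 0 else signMat β * signMat α with hg
  have hp : (0 : ℝ) < 2 ^ (n * n) := by positivity
  have hgood : ∑ β, ∑ α, w β α • g β α ∈ absConvexHull ℝ (signProducts n) := by
    rw [← Fintype.sum_prod_type' (f := fun β α => w β α • g β α)]
    refine convex_absConvexHull.sum_mem (fun p _ => hw0 _ _) ?_ fun p _ => ?_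
    · rw [Fintype.sum_prod_type' (f := fun β α => w β α)]
      simp_rw [hw1]
      simp
    · simp only [hg]
      split_ifs with h
      · exact h0
      · simp only [hbad, Finset.mem_filter, Finset.mem_univ, true_and, not_or, not_lt] at h
        exact subset_absConvexHull ⟨_, _, h.1, h.2, rfl⟩
  refine ⟨_, hgood, ?_⟩
  set T := ∑ β, ∑ α, w β α • (signMat β * signMat α) with hT
  -- Each of the `n` terms in the matrix product has the same expectation, independent of `j`, and
  -- the two factors `1 / √n` average them.
  have hTe : ∀ i k, T i k = 2 / Real.pi * Real.arcsin (u i k) := by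
    intro i k
    have e : T i k = ∑ j, (∑ β, ∑ α, w β α * (((β (i, j) : ℤ) : ℝ) * ((α (j, k) : ℤ) : ℝ))) / n := by
      simp_rw [Finset.sum_div]
      rw [hT]
      simp only [Matrix.sum_apply, Matrix.smul_apply, Matrix.mul_apply, signMat, Matrix.of_apply,
        smul_eq_mul]
      symm
      rw [Finset.sum_comm]
      refine Finset.sum_congr rfl fun β _ => ?_
      rw [Finset.sum_comm]
      refine Finset.sum_congr rfl fun α _ => ?_
      rw [Finset.mul_sum]
      refine Finset.sum_congr rfl fun j _ => ?_
      rw [div_mul_div_comm, hss, mul_div_assoc]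
    rw [e]
    simp_rw [hw, hYX]
    simp
    field_simp
  have hmain : ‖u - (Real.pi / 2) • T‖ ≤ 2 / 3 := by
    refine Matrix.l2_opNorm_le_of_abs_le_sq (by norm_num) hu fun i k => ?_
    have hent : |u i k| ≤ 1 := by
      have h1 := Matrix.sum_sq_row_le hu i
      have h2 := (Finset.single_le_sum (f := fun k => ‖u i k‖ ^ 2) (fun k _ => sq_nonneg _)
        (Finset.mem_univ k)).trans h1
      rw [one_pow, Real.norm_eq_abs] at h2
      exact (sq_le_one_iff₀ (abs_nonneg _)).1 h2
    have e : (u - (Real.pi / 2) • T) i k = -(Real.arcsin (u i k) - u i k) := by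
      rw [Matrix.sub_apply, Matrix.smul_apply, hTe, smul_eq_mul]
      field_simp
      ring
    rw [e, abs_neg]
    exact abs_arcsin_sub_le hent
  -- Union bound: only the two uniform marginals of the coupling matter here.
  have hsumbad : ∑ β, ∑ α, (if β ∈ bad ∨ α ∈ bad then w β α else 0) ≤
      2 * (bad.card / 2 ^ (n * n)) := by
    have h1 : ∑ β, ∑ α, (if β ∈ bad then w β α else 0) = bad.card / 2 ^ (n * n) := by
      simp_rw [Finset.sum_ite_irrel, hw1]
      simp [Finset.sum_ite_mem, div_eq_mul_inv]
    have h2 : ∑ β, ∑ α, (if α ∈ bad then w β α else 0) = bad.card / 2 ^ (n * n) := by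
      rw [Finset.sum_comm]
      simp_rw [Finset.sum_ite_irrel, hw2]
      simp [Finset.sum_ite_mem, div_eq_mul_inv]
    rw [two_mul]
    nth_rewrite 1 [← h1]
    rw [← h2, ← Finset.sum_add_distrib]
    refine Finset.sum_le_sum fun β _ => ?_
    rw [← Finset.sum_add_distrib]
    refine Finset.sum_le_sum fun α _ => ?_
    have := hw0 β α
    by_cases hb : β ∈ bad <;> by_cases ha : α ∈ bad <;> simp [hb, ha, this]
  have herr : ‖T - ∑ β, ∑ α, w β α • g β α‖ ≤ 1 / 10 := by
    rw [hT, ← Finset.sum_sub_distrib]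
    simp_rw [← Finset.sum_sub_distrib, ← smul_sub]
    calc ‖∑ β, ∑ α, w β α • (signMat β * signMat α - g β α)‖
        ≤ ∑ β, ∑ α, (if β ∈ bad ∨ α ∈ bad then w β α else 0) * n := by
          refine (norm_sum_le _ _).trans (Finset.sum_le_sum fun β _ => ?_)
          refine (norm_sum_le _ _).trans (Finset.sum_le_sum fun α _ => ?_)
          simp only [hg]
          split_ifs with h
          · rw [sub_zero, norm_smul, Real.norm_eq_abs, abs_of_nonneg (hw0 β α), ← hss]
            refine mul_le_mul_of_nonneg_left ?_ (hw0 β α)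
            exact (norm_mul_le _ _).trans
              (mul_le_mul (norm_signMat_le hn β) (norm_signMat_le hn α) (norm_nonneg _) hs0)
          · simp
      _ = (∑ β, ∑ α, (if β ∈ bad ∨ α ∈ bad then w β α else 0)) * n := by
          simp_rw [Finset.sum_mul]
      _ ≤ 2 * (bad.card / 2 ^ (n * n)) * n := by gcongr
      _ = 2 * (bad.card * n) / 2 ^ (n * n) := by ring
      _ ≤ 1 / 10 := by
          rw [div_le_iff₀ hp]
          linarith
  calc _ = ‖(u - (Real.pi / 2) • T) + (Real.pi / 2) • (T - ∑ β, ∑ α, w β α • g β α)‖ := by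
        congr 1
        rw [smul_sub]
        abel
    _ ≤ 2 / 3 + (Real.pi / 2) * (1 / 10) := by
        refine (norm_add_le _ _).trans (add_le_add hmain ?_)
        rw [norm_smul, Real.norm_eq_abs, abs_of_pos (by positivity)]
        gcongr
    _ ≤ 5 / 6 := by linarith

theorem closedBall_subset_absConvexHull_signProducts {n : ℕ} (hn : 1 ≤ n) :
    Metric.closedBall (0 : Matrix (Fin n) (Fin n) ℝ) 1 ⊆
      (3 * Real.pi) • absConvexHull ℝ (signProducts n) := by
  have hfin := signProducts_finite n
  have h := closedBall_subset_smul_of_approx (K := absConvexHull ℝ (signProducts n))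
    convex_absConvexHull
    (by
      rw [← convexHull_union_neg_eq_absConvexHull]
      exact (hfin.union hfin.neg).isClosed_convexHull ℝ)
    (zero_mem_absConvexHull_signProducts hn)
    (c := Real.pi / 2) (q := 5 / 6) (by positivity) (by norm_num) (by norm_num)
    fun u hu => exists_approx_signProducts hn hu
  have e : Real.pi / 2 / (1 - 5 / 6) = 3 * Real.pi := by ring
  rwa [e] at h

/-! ### Passage from real to complex matrices. -/

section Complexification

variable {m : Type*} [Fintype m] [DecidableEq m]

/-- A real matrix acts separately on the real and imaginary parts of a vector. -/
theorem Matrix.l2_opNorm_map_ofReal_le (M : Matrix m m ℝ) :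
    ‖M.map ((↑) : ℝ → ℂ)‖ ≤ ‖M‖ := by
  refine Matrix.l2_opNorm_le_of_sum_sq_le (norm_nonneg _) fun v => ?_
  have hre := Matrix.sum_sq_mulVec_le (le_refl ‖M‖) (fun k => (v k).re)
  have him := Matrix.sum_sq_mulVec_le (le_refl ‖M‖) (fun k => (v k).im)
  simp only [Real.norm_eq_abs, sq_abs] at hre him
  have e1 : ∀ i, ‖((M.map ((↑) : ℝ → ℂ)).mulVec v) i‖ ^ 2 =
      (M.mulVec fun k => (v k).re) i ^ 2 + (M.mulVec fun k => (v k).im) i ^ 2 := by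
    intro i
    rw [Complex.sq_norm, Complex.normSq_apply, ← sq, ← sq]
    simp [Matrix.mulVec, dotProduct, Complex.re_sum, Complex.im_sum]
  have e2 : ∀ k, ‖v k‖ ^ 2 = (v k).re ^ 2 + (v k).im ^ 2 := by
    intro k
    rw [Complex.sq_norm, Complex.normSq_apply, ← sq, ← sq]
  simp_rw [e1, e2, Finset.sum_add_distrib, mul_add]
  exact add_le_add hre him

theorem Matrix.l2_opNorm_map_re_le (z : Matrix m m ℂ) : ‖z.map Complex.re‖ ≤ ‖z‖ := by
  refine Matrix.l2_opNorm_le_of_sum_sq_le (norm_nonneg _) fun v => ?_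
  have h := Matrix.sum_sq_mulVec_le (le_refl ‖z‖) (fun k => (v k : ℂ))
  simp only [Complex.norm_real] at h
  refine le_trans (Finset.sum_le_sum fun i _ => ?_) h
  gcongr
  refine le_trans (le_of_eq ?_) (Complex.abs_re_le_norm _)
  simp [Matrix.mulVec, dotProduct, Complex.re_sum]

theorem Matrix.l2_opNorm_map_im_le (z : Matrix m m ℂ) : ‖z.map Complex.im‖ ≤ ‖z‖ := by
  have h := Matrix.l2_opNorm_map_re_le ((-Complex.I) • z)
  have e : ((-Complex.I) • z).map Complex.re = z.map Complex.im := by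
    ext i j
    simp
  rw [e, norm_smul] at h
  simpa using h

end Complexification

theorem map_signMat_mem {n : ℕ} {ε : Fin n × Fin n → ℤˣ} {χ : ℝ} (h : ‖signMat ε‖ ≤ χ) :
    (signMat ε).map ((↑) : ℝ → ℂ) ∈ signMatrices χ n := by
  refine ⟨fun i j => ?_, (Matrix.l2_opNorm_map_ofReal_le _).trans h⟩
  rw [Matrix.map_apply, signMat, Matrix.of_apply]
  rcases Int.units_eq_one_or (ε (i, j)) with h | h <;> rw [h]
  · left; simp
  · right; simp [neg_div]

theorem map_mem_absConvexHull {n : ℕ} {k : Matrix (Fin n) (Fin n) ℝ}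
    (hk : k ∈ absConvexHull ℝ (signProducts n)) :
    k.map ((↑) : ℝ → ℂ) ∈ absConvexHull ℂ (signMatrices 50 n * signMatrices 50 n) := by
  have hsub : absConvexHull ℝ (signProducts n) ⊆ {k : Matrix (Fin n) (Fin n) ℝ |
      k.map ((↑) : ℝ → ℂ) ∈ absConvexHull ℂ (signMatrices 50 n * signMatrices 50 n)} := by
    refine absConvexHull_min ?_ ⟨?_, ?_⟩
    · rintro M ⟨β, α, hβ, hα, rfl⟩
      refine subset_absConvexHull ⟨_, map_signMat_mem hβ, _, map_signMat_mem hα, ?_⟩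
      exact (Matrix.map_mul (f := Complex.ofRealHom)).symm
    · rintro a ha _ ⟨M, hM, rfl⟩
      have e : (a • M).map ((↑) : ℝ → ℂ) = (a : ℂ) • M.map ((↑) : ℝ → ℂ) := by
        ext i j; simp
      change (a • M).map ((↑) : ℝ → ℂ) ∈
        absConvexHull ℂ (signMatrices 50 n * signMatrices 50 n)
      rw [e]
      exact balanced_absConvexHull.smul_mem (by simpa using ha) hM
    · intro M hM N hN a b ha hb hab
      have e : (a • M + b • N).map ((↑) : ℝ → ℂ) =
          (a : ℂ) • M.map ((↑) : ℝ → ℂ) + (b : ℂ) • N.map ((↑) : ℝ → ℂ) := by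
        ext i j; simp
      change (a • M + b • N).map ((↑) : ℝ → ℂ) ∈
        absConvexHull ℂ (signMatrices 50 n * signMatrices 50 n)
      rw [e]
      exact convex_absConvexHull hM hN (by exact_mod_cast ha) (by exact_mod_cast hb)
        (by exact_mod_cast hab)
  exact hsub hk

theorem closedBall_subset_absConvexHull_signMatrices {n : ℕ} (hn : 1 ≤ n) :
    Metric.closedBall (0 : Matrix (Fin n) (Fin n) ℂ) 1 ⊆
      (6 * Real.pi) • absConvexHull ℂ (signMatrices 50 n * signMatrices 50 n) := by
  intro z hz
  rw [mem_closedBall_zero_iff] at hz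
  obtain ⟨k, hk, hkz⟩ := closedBall_subset_absConvexHull_signProducts hn
    (mem_closedBall_zero_iff.2 ((Matrix.l2_opNorm_map_re_le z).trans hz))
  obtain ⟨l, hl, hlz⟩ := closedBall_subset_absConvexHull_signProducts hn
    (mem_closedBall_zero_iff.2 ((Matrix.l2_opNorm_map_im_le z).trans hz))
  have hl' := balanced_absConvexHull.smul_mem (a := Complex.I) (by simp) (map_mem_absConvexHull hl)
  -- The midpoint of the representatives of `Re z` and `i Im z` turns `3π` for each into `6π` for
  -- their sum.
  refine ⟨_, convex_absConvexHull (map_mem_absConvexHull hk) hl' (a := ((1 / 2 : ℝ) : ℂ))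
    (b := ((1 / 2 : ℝ) : ℂ)) (by rw [Complex.zero_le_real]; norm_num)
    (by rw [Complex.zero_le_real]; norm_num) (by norm_num), ?_⟩
  ext i j
  have h1 := congrFun (congrFun hkz i) j
  have h2 := congrFun (congrFun hlz i) j
  simp only [Matrix.smul_apply, Matrix.map_apply, smul_eq_mul] at h1 h2
  rw [← Complex.re_add_im (z i j), ← h1, ← h2]
  simp
  ring

/-! ### Norm and trace bounds on the hull; trace duality and conclusion. -/

theorem norm_le_sq_of_mem_absConvexHull {χ : ℝ} (hχ : 0 ≤ χ) {n : ℕ}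
    {k : Matrix (Fin n) (Fin n) ℂ}
    (hk : k ∈ absConvexHull ℂ (signMatrices χ n * signMatrices χ n)) : ‖k‖ ≤ χ ^ 2 := by
  have h : absConvexHull ℂ (signMatrices χ n * signMatrices χ n) ⊆
      Metric.closedBall (0 : Matrix (Fin n) (Fin n) ℂ) (χ ^ 2) := by
    refine absConvexHull_min ?_ ⟨balanced_closedBall_zero, ?_⟩
    · rintro _ ⟨a, ha, b, hb, rfl⟩
      rw [mem_closedBall_zero_iff, sq]
      exact (norm_mul_le _ _).trans (mul_le_mul ha.2 hb.2 (norm_nonneg _) hχ)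
    · intro x hx y hy a b ha hb hab
      rw [mem_closedBall_zero_iff] at *
      have h1 : ‖a‖ + ‖b‖ = 1 := by
        have : ((‖a‖ + ‖b‖ : ℝ) : ℂ) = 1 := by
          push_cast
          rw [Complex.norm_of_nonneg' ha, Complex.norm_of_nonneg' hb, hab]
        exact_mod_cast this
      calc ‖a • x + b • y‖ ≤ ‖a‖ * ‖x‖ + ‖b‖ * ‖y‖ := by
            rw [← norm_smul, ← norm_smul]; exact norm_add_le _ _
        _ ≤ ‖a‖ * χ ^ 2 + ‖b‖ * χ ^ 2 := by gcongr
        _ = χ ^ 2 := by rw [← add_mul, h1, one_mul]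
  simpa using h hk

theorem norm_trace_mul_le_of_mem_absConvexHull {χ : ℝ} {n : ℕ} (x : Matrix (Fin n) (Fin n) ℂ)
    {k : Matrix (Fin n) (Fin n) ℂ}
    (hk : k ∈ absConvexHull ℂ (signMatrices χ n * signMatrices χ n)) :
    ‖Matrix.trace (x * k)‖ ≤
      ⨆ p : signMatrices χ n × signMatrices χ n, ‖Matrix.trace (x * p.1.val * p.2.val)‖ := by
  have : Finite (signMatrices χ n) := signMatrices_finite χ n
  set s := ⨆ p : signMatrices χ n × signMatrices χ n, ‖Matrix.trace (x * p.1.val * p.2.val)‖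
  have h : absConvexHull ℂ (signMatrices χ n * signMatrices χ n) ⊆
      {k | ‖Matrix.trace (x * k)‖ ≤ s} := by
    refine absConvexHull_min ?_ ⟨?_, ?_⟩
    · rintro _ ⟨a, ha, b, hb, rfl⟩
      have := le_ciSup (f := fun p : signMatrices χ n × signMatrices χ n =>
        ‖Matrix.trace (x * p.1.val * p.2.val)‖) (Set.finite_range _).bddAbove (⟨a, ha⟩, ⟨b, hb⟩)
      change ‖Matrix.trace (x * (a * b))‖ ≤ s
      rwa [← mul_assoc]
    · rintro a ha _ ⟨M, hM, rfl⟩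
      change ‖Matrix.trace (x * (a • M))‖ ≤ s
      rw [Matrix.mul_smul, Matrix.trace_smul, norm_smul]
      exact (mul_le_of_le_one_left (norm_nonneg _) ha).trans hM
    · intro y hy z hz a b ha hb hab
      have h1 : ‖a‖ + ‖b‖ = 1 := by
        have : ((‖a‖ + ‖b‖ : ℝ) : ℂ) = 1 := by
          push_cast
          rw [Complex.norm_of_nonneg' ha, Complex.norm_of_nonneg' hb, hab]
        exact_mod_cast this
      change ‖Matrix.trace (x * (a • y + b • z))‖ ≤ s
      rw [Matrix.mul_add, Matrix.mul_smul, Matrix.mul_smul, Matrix.trace_add, Matrix.trace_smul,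
        Matrix.trace_smul]
      calc _ ≤ ‖a‖ * ‖Matrix.trace (x * y)‖ + ‖b‖ * ‖Matrix.trace (x * z)‖ := by
            rw [← norm_smul, ← norm_smul]; exact norm_add_le _ _
        _ ≤ ‖a‖ * s + ‖b‖ * s := by gcongr; exacts [hy, hz]
        _ = s := by rw [← add_mul, h1, one_mul]
  exact h hk

/-- The trace norm is attained by duality with a contraction. -/
theorem exists_contraction_trace_eq {n : ℕ} (x : Matrix (Fin n) (Fin n) ℂ) :
    ∃ u : Matrix (Fin n) (Fin n) ℂ, ‖u‖ ≤ 1 ∧ Matrix.trace (x * u) = Matrix.trace (CFC.abs x) := by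
  set a := CFC.abs x with ha
  have ha0 : 0 ≤ a := CFC.abs_nonneg x
  have hsa : IsSelfAdjoint a := IsSelfAdjoint.of_nonneg ha0
  have haa : a * a = star x * x := CFC.abs_mul_abs x
  have hfin : (spectrum ℝ a).Finite := Matrix.finite_real_spectrum
  have hcont : ∀ f : ℝ → ℝ, ContinuousOn f (spectrum ℝ a) := fun f => hfin.continuousOn f
  -- Since `0⁻¹ = 0`, `g` is the pseudo-inverse of `|x|`, and `g * star x` is the adjoint of the
  -- polar part of `x`. The finite spectrum makes the discontinuous function `t⁻¹` admissible.
  set g := cfc (fun t : ℝ => t⁻¹) a with hg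
  have hid : cfc (fun t : ℝ => t) a = a := cfc_id' ℝ a
  have hgs : star g = g := (cfc_predicate (R := ℝ) (p := IsSelfAdjoint) _ a).star_eq
  have hgaa : g * (a * a) = a := by
    calc g * (a * a) = cfc (fun t : ℝ => t⁻¹) a *
          (cfc (fun t : ℝ => t) a * cfc (fun t : ℝ => t) a) := by rw [hid]
      _ = cfc (fun t : ℝ => t⁻¹ * (t * t)) a := by
          rw [← cfc_mul _ _ a (hcont _) (hcont _), ← cfc_mul _ _ a (hcont _) (hcont _)]
      _ = cfc (fun t : ℝ => t) a := by
          congr 1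
          funext t
          by_cases h : t = 0
          · simp [h]
          · field_simp
      _ = a := hid
  have hag : ‖a * g‖ ≤ 1 := by
    nth_rewrite 1 [← hid]
    rw [hg, ← cfc_mul _ _ a (hcont _) (hcont _)]
    refine norm_cfc_le zero_le_one fun t _ => ?_
    by_cases h : t = 0
    · simp [h]
    · simp [h]
  refine ⟨g * star x, ?_, ?_⟩
  · have h1 : ‖g * star x‖ * ‖g * star x‖ = ‖star (a * g) * (a * g)‖ := by
      rw [← CStarRing.norm_self_mul_star, star_mul, star_star, star_mul, hgs, hsa.star_eq]
      congr 1
      calc g * star x * (x * g) = g * (star x * x) * g := by simp only [mul_assoc]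
        _ = _ := by rw [← haa]; simp only [mul_assoc]
    rw [CStarRing.norm_star_mul_self] at h1
    have h2 : ‖a * g‖ * ‖a * g‖ ≤ 1 := mul_le_one₀ hag (norm_nonneg _) hag
    nlinarith [norm_nonneg (g * star x)]
  · rw [← mul_assoc, Matrix.trace_mul_comm, ← mul_assoc, Matrix.trace_mul_comm, ← haa, hgaa]

theorem mainTheorem10 :
    ∃ χ : ℝ, 1 ≤ χ ∧ ∃ C : ℝ, 0 < C ∧ ∀ n : ℕ, 1 ≤ n →
      (∀ x : Matrix (Fin n) (Fin n) ℂ,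
        traceNorm x ≤
          C * ⨆ p : signMatrices χ n × signMatrices χ n,
            ‖Matrix.trace (x * p.1.val * p.2.val)‖) ∧
      (χ ^ 2)⁻¹ • absConvexHull ℂ (signMatrices χ n * signMatrices χ n) ⊆
        Metric.closedBall (0 : Matrix (Fin n) (Fin n) ℂ) 1 ∧
      Metric.closedBall (0 : Matrix (Fin n) (Fin n) ℂ) 1 ⊆
        C • absConvexHull ℂ (signMatrices χ n * signMatrices χ n) := by
  have hpi := Real.pi_pos
  refine ⟨50, by norm_num, 6 * Real.pi, by positivity, fun n hn => ⟨fun x => ?_, ?_,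
    closedBall_subset_absConvexHull_signMatrices hn⟩⟩
  · obtain ⟨u, hu, hxu⟩ := exists_contraction_trace_eq x
    obtain ⟨k, hk, rfl⟩ := closedBall_subset_absConvexHull_signMatrices hn
      (mem_closedBall_zero_iff.2 hu)
    calc traceNorm x ≤ ‖Matrix.trace (CFC.abs x)‖ := Complex.re_le_norm _
      _ = 6 * Real.pi * ‖Matrix.trace (x * k)‖ := by
          rw [← hxu, Matrix.mul_smul, Matrix.trace_smul, norm_smul, Real.norm_eq_abs,
            abs_of_pos (by positivity)]
      _ ≤ _ := by
          gcongr
          exact norm_trace_mul_le_of_mem_absConvexHull x hk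
  · rintro _ ⟨k, hk, rfl⟩
    have h := norm_le_sq_of_mem_absConvexHull (by norm_num) hk
    rw [mem_closedBall_zero_iff, norm_smul, norm_inv, Real.norm_eq_abs, abs_of_pos (by norm_num),
      inv_mul_le_iff₀ (by norm_num), mul_one]
    exact h
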